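/- For a positive integer $n$ let $\Omega_n=\{0,\pm1,\dots,\pm n\}$ and let $\mathfrak{B}_n$ be the hyperoctahedral group of signed permutations of length $n$, i.e. the group of bijections $\pi:\Omega_n\to\Omega_n$ such that $\pi(a)=b$ implies $\pi(-a)=-b$. Write $\pi_k=\pi(k)$ (so $\pi_0=0$). With respect to the natural order of the integers, a descent of $\pi$ is an index $k\in\{0,1,\dots,n-1\}$ with $\pi_k>\pi_{k+1}$, and an inverse descent of $\pi$ is a descent of $\pi^{-1}$. For integers $i,j$ let $\overline{b}_{n,i,j}$ be the number of $\pi\in\mathfrak{B}_n$ with exactly $i$ descents and exactly $j$ inverse descents. Then for all $n\ge 2$ and $0\le i,j\le n$, $$\begin{aligned} n\,\overline{b}_{n,i,j}={}&(n+i+j+2ij)\,\overline{b}_{n-1,i,j}\\ &+\bigl((2n-1)i-(2i+1)(j-1)\bigr)\,\overline{b}_{n-1,i,j-1}\\ &+\bigl((2n-1)j-(2j+1)(i-1)\bigr)\,\overline{b}_{n-1,i-1,j}\\ &+\bigl((2n^2-n)+2(i-1)(j-1)+(1-2n)(i+j-2)\bigr)\,\overline{b}_{n-1,i-1,j-1},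 \end{aligned}$$ where $\overline{b}_{1,0,0}=\overline{b}_{1,1,1}=1$, $\overline{b}_{1,0,1}=\overline{b}_{1,1,0}=0$, and, for every $n\ge1$, $\overline{b}_{n,i,j}=0$ if $i<0$ or $j<0$. -/

import Mathlib

/-- The set `Ω_n = {0, 1, -1, …, n, -n}` of integers, with the natural order of `ℤ`. -/
abbrev Omega (n : ℕ) : Type := Set.Icc (-(n : ℤ)) (n : ℤ)

/-- An index `k` with `0 ≤ k ≤ n`, as an element of `Ω_n`. -/
def Omega.idx {n : ℕ} (k : ℕ) (hk : k ≤ n) : Omega n :=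
  ⟨(k : ℤ), by constructor <;> omega⟩

/-- The hyperoctahedral group `B_n`: the bijections `π : Ω_n → Ω_n` such that `π a = b` implies
`π (-a) = -b`, as a subgroup of the group of all bijections of `Ω_n`. -/
def hyperoctahedral (n : ℕ) : Subgroup (Equiv.Perm (Omega n)) where
  carrier := {π | ∀ a a' : Omega n, (a' : ℤ) = -(a : ℤ) → (π a' : ℤ) = -(π a : ℤ)}
  one_mem' := fun _ _ h => h
  mul_mem' := fun {π ρ} hπ hρ a a' h => hπ (ρ a) (ρ a') (hρ a a' h)
  inv_mem' := by
    intro π hπ a a' h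
    have hmem : -((π⁻¹ a : Omega n) : ℤ) ∈ Set.Icc (-(n : ℤ)) (n : ℤ) := by
      have h2 := (π⁻¹ a).2
      rw [Set.mem_Icc] at h2 ⊢
      omega
    have key := hπ (π⁻¹ a) ⟨_, hmem⟩ rfl
    rw [show π (π⁻¹ a) = a from π.apply_symm_apply a, ← h] at key
    have h3 : π ⟨_, hmem⟩ = a' := Subtype.ext key
    rw [← h3, show ∀ x, π⁻¹ (π x) = x from π.symm_apply_apply]

/-- The number of `i ∈ {0, …, n-1}` with `π_i > π_{i+1}` in the natural order, where `π_k = π k`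
(so that `π_0 = π 0 = 0`). -/
def desB {n : ℕ} (π : hyperoctahedral n) : ℕ :=
  (Finset.univ.filter fun i : Fin n =>
    (π.1 (Omega.idx i i.isLt.le) : ℤ) > (π.1 (Omega.idx (i + 1) i.isLt) : ℤ)).card

/-- The number of inverse descents of `π`, i.e. of `i ∈ {0, …, n-1}` with
`π⁻¹_i > π⁻¹_{i+1}` in the natural order. -/
def idesB {n : ℕ} (π : hyperoctahedral n) : ℕ := desB π⁻¹

/-- The number of `π ∈ B_n` with `i` descents and `j` inverse descents, for arbitrary integers
`i` and `j`. -/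
noncomputable def bCount (n : ℕ) (i j : ℤ) : ℕ :=
  Set.ncard {π : hyperoctahedral n | (desB π : ℤ) = i ∧ (idesB π : ℤ) = j}

/-! The recurrence follows from the identity, for `n ≥ 1`, ∑ b(n,i,j) C(k+n-i, n) C(l+n-j, n) =
C(2kl+k+l+n, n) (`sum_bCount_mul_choose`).

By `card_barSeq`, C(k+n-des π, n) counts the odd sequences bounded by k that increase weakly, and
strictly at the descents of π. So the left side counts triples of π with such sequences a for π and
b for π⁻¹. Since (2k+1)(2l+1) = 2(2kl+k+l)+1, the pairs (b, a∘π⁻¹) are the balanced base-(2k+1)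
digits of integers of absolute value at most 2kl+k+l. Hence the triples match the weakly increasing
odd sequences with that bound (`mergeSeq_bijective`), which the right side counts.

The identities for all k, l form a unitriangular system for the numbers b(n,i,j)
(`eq_of_sum_choose_eq`). It therefore suffices to sum both sides of the recurrence against the
binomials, where shifting indices leaves a polynomial identity. -/

/-! ### Balanced digits and sorting of odd functions -/

/-- Comparing `a * (2 * k + 1) + p` for `|p| ≤ k` is comparing the pairs `(a, p)`
lexicographically. -/
theorem mul_add_lt_iff_lex {k a b p q : ℤ} (hp : |p| ≤ k) (hq : |q| ≤ k) :
    a * (2 * k + 1) + p < b * (2 * k + 1) + q ↔ a < b ∨ (a = b ∧ p < q) := by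
  rw [abs_le] at hp hq
  rcases lt_trichotomy a b with h | h | h
  · simp only [h, true_or, iff_true]
    nlinarith
  · subst h; simp
  · have : ¬ (a < b ∨ (a = b ∧ p < q)) := by omega
    simp only [this, iff_false, not_lt]
    nlinarith

theorem mul_add_inj {k a b p q : ℤ} (hp : |p| ≤ k) (hq : |q| ≤ k)
    (h : a * (2 * k + 1) + p = b * (2 * k + 1) + q) : a = b ∧ p = q := by
  have h1 := (mul_add_lt_iff_lex (a := a) (b := b) hp hq).not.1 h.not_lt
  have h2 := (mul_add_lt_iff_lex (a := b) (b := a) hq hp).not.1 h.not_gt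
  omega

/-- A function on `Ω_n` commuting with negation. -/
def OddOn {n : ℕ} (f : Omega n → ℤ) : Prop :=
  ∀ x y : Omega n, (y : ℤ) = -(x : ℤ) → f y = -f x

theorem Omega.abs_le {n : ℕ} (x : Omega n) : |(x : ℤ)| ≤ n := _root_.abs_le.2 x.2

/-- The negative of an element of `Ω_n`. -/
def Omega.neg {n : ℕ} (x : Omega n) : Omega n :=
  ⟨-(x : ℤ), by have := x.2; rw [Set.mem_Icc] at this ⊢; omega⟩

theorem Omega.exists_idx {n : ℕ} {x : Omega n} (hx : 0 ≤ (x : ℤ)) :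
    ∃ (j : ℕ) (hj : j ≤ n), x = Omega.idx j hj := by
  have h := x.2.2
  refine ⟨(x : ℤ).toNat, by omega, Subtype.ext ?_⟩
  simp only [Omega.idx]
  omega

theorem OddOn.map_zero {n : ℕ} {f : Omega n → ℤ} (hf : OddOn f) :
    f (Omega.idx 0 n.zero_le) = 0 := by
  have := hf (Omega.idx 0 n.zero_le) (Omega.idx 0 n.zero_le) (by simp [Omega.idx])
  omega

/-- Oddness reflects the negative half onto the positive one, and pairs of opposite sign are
compared through f(0) = 0. -/
theorem OddOn.strictMono {n : ℕ} {f : Omega n → ℤ} (hf : OddOn f)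
    (h : ∀ i : Fin n, f (Omega.idx i i.isLt.le) < f (Omega.idx (i + 1) i.isLt)) :
    StrictMono f := by
  have h0 := hf.map_zero
  have hg : StrictMono fun j : Fin (n + 1) => f (Omega.idx j (Nat.lt_succ_iff.1 j.isLt)) :=
    Fin.strictMono_iff_lt_succ.2 fun i => by simpa using h i
  have hpos : ∀ x y : Omega n, 0 ≤ (x : ℤ) → (x : ℤ) < y → f x < f y := by
    intro x y hx hxy
    obtain ⟨i, hi, rfl⟩ := Omega.exists_idx hx
    obtain ⟨j, hj, rfl⟩ := Omega.exists_idx (hx.trans hxy.le)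
    simp only [Omega.idx, Nat.cast_lt] at hxy
    exact hg (show (⟨i, by omega⟩ : Fin (n + 1)) < ⟨j, by omega⟩ from hxy)
  intro x y hxy
  have hxy' : (x : ℤ) < y := hxy
  by_cases hx : 0 ≤ (x : ℤ)
  · exact hpos x y hx hxy
  have hnx := hf x x.neg rfl
  by_cases hy : (y : ℤ) ≤ 0
  · have := hpos y.neg x.neg (by simpa [Omega.neg] using hy) (by simpa [Omega.neg] using hxy')
    have hny := hf y y.neg rfl
    omega
  · have h1 := hpos (Omega.idx 0 n.zero_le) x.neg le_rfl (by simp [Omega.neg, Omega.idx]; omega)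
    have h2 := hpos (Omega.idx 0 n.zero_le) y le_rfl (by simp [Omega.idx]; omega)
    omega

/-- An injective odd function on `Ω_n` is sorted by a unique permutation, which is signed. -/
theorem existsUnique_strictMono_comp {n : ℕ} {f : Omega n → ℤ} (hf : OddOn f)
    (hinj : Function.Injective f) :
    ∃! π : hyperoctahedral n, StrictMono fun x => f (π.1 x) := by
  have huniq : ∀ σ τ : Equiv.Perm (Omega n), StrictMono (fun x => f (σ x)) →
      StrictMono (fun x => f (τ x)) → σ = τ := by
    intro σ τ hσ hτ
    have := (StrictMono.range_inj hσ hτ).1 (by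
      change Set.range (f ∘ σ) = Set.range (f ∘ τ)
      rw [σ.surjective.range_comp, τ.surjective.range_comp])
    ext x
    exact congrArg _ (hinj (congrFun this x))
  have e : Omega n ≃o Set.range f :=
    (Fintype.orderIsoFinOfCardEq (Omega n) rfl).symm.trans
      (Fintype.orderIsoFinOfCardEq (Set.range f) (Set.card_range_of_injective hinj))
  let σ : Equiv.Perm (Omega n) := e.toEquiv.trans (Equiv.ofInjective f hinj).symm
  have hσf : ∀ x, f (σ x) = e x := fun x => Equiv.apply_ofInjective_symm hinj (e x)
  have hσ : StrictMono fun x => f (σ x) := by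
    intro x y hxy
    simp only [hσf]
    exact e.strictMono hxy
  let ν : Equiv.Perm (Omega n) := ⟨Omega.neg, Omega.neg, fun x => Subtype.ext (neg_neg _),
    fun x => Subtype.ext (neg_neg _)⟩
  have hν : ∀ x, (ν x : ℤ) = -(x : ℤ) := fun x => rfl
  -- Conjugating by negation gives another sorting permutation, so uniqueness forces σ to be signed.
  have hodd : ν.trans (σ.trans ν) = σ := by
    refine huniq _ _ (fun x y hxy => ?_) hσ
    have h1 := hf (σ (ν x)) (ν (σ (ν x))) (hν _)
    have h2 := hf (σ (ν y)) (ν (σ (ν y))) (hν _)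
    have h3 : f (σ (ν y)) < f (σ (ν x)) := hσ (show (ν y : ℤ) < ν x by
      have : (x : ℤ) < y := hxy
      simp only [hν]; omega)
    simp only [Equiv.trans_apply]
    omega
  refine ⟨⟨σ, fun a a' h => ?_⟩, hσ, fun τ hτ => Subtype.ext (huniq _ _ hτ hσ)⟩
  have ha : a' = ν a := Subtype.ext h
  rw [ha]
  conv_rhs => rw [← hodd]
  simp only [Equiv.trans_apply, hν, neg_neg]

/-! ### Compatible sequences and the merging bijection -/

/-- Odd functions `a` on `Ω_n` bounded by `k` which are weakly increasing, and for which `π` is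
increasing where `a` is constant. -/
def barSeq {n : ℕ} (π : hyperoctahedral n) (k : ℕ) : Set (Omega n → ℤ) :=
  {a | OddOn a ∧ (∀ x, |a x| ≤ k) ∧ ∀ x y, x < y → a x < a y ∨ (a x = a y ∧ π.1 x < π.1 y)}

theorem barSeq_one {n : ℕ} (k : ℕ) :
    barSeq (1 : hyperoctahedral n) k = {a | OddOn a ∧ (∀ x, |a x| ≤ k) ∧ Monotone a} := by
  ext a
  refine and_congr_right fun _ => and_congr_right fun _ => ⟨fun h x y hxy => ?_, fun h x y hxy => ?_⟩
  · rcases hxy.eq_or_lt with rfl | hlt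
    · rfl
    · rcases h x y hlt with h | h
      exacts [h.le, h.1.le]
  · rcases (h hxy.le).lt_or_eq with h | h
    exacts [.inl h, .inr ⟨h, hxy⟩]

theorem barSeq_finite {n : ℕ} (π : hyperoctahedral n) (k : ℕ) : (barSeq π k).Finite := by
  refine (Set.Finite.pi' (fun _ : Omega n => Set.finite_Icc (-(k : ℤ)) k)).subset ?_
  exact fun a ha x => abs_le.1 (ha.2.1 x)

instance {n : ℕ} (π : hyperoctahedral n) (k : ℕ) : Finite (barSeq π k) := barSeq_finite π k

theorem monotone_of_mem_barSeq {n : ℕ} {π : hyperoctahedral n} {k : ℕ} {a : Omega n → ℤ}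
    (ha : a ∈ barSeq π k) : Monotone a := by
  intro x y hxy
  rcases hxy.eq_or_lt with rfl | hlt
  · rfl
  · rcases ha.2.2 x y hlt with h | h
    exacts [h.le, h.1.le]

theorem oddOn_perm {n : ℕ} (π : hyperoctahedral n) : OddOn fun x => (π.1 x : ℤ) := π.2

theorem inv_val_apply {n : ℕ} (π : hyperoctahedral n) (x : Omega n) :
    π.1 ((π⁻¹).1 x) = x := π.1.apply_symm_apply x

theorem inv_val_apply' {n : ℕ} (π : hyperoctahedral n) (x : Omega n) :
    (π⁻¹).1 (π.1 x) = x := π.1.symm_apply_apply x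

/-- The multiset of points described by a signed permutation with two compatible sequences,
listed in increasing order. -/
def mergeSeq {n : ℕ} (k : ℕ) (π : hyperoctahedral n) (a b : Omega n → ℤ) : Omega n → ℤ :=
  fun x => b x * (2 * k + 1) + a ((π⁻¹).1 x)

theorem mergeSeq_mem {n k l : ℕ} {π : hyperoctahedral n} {a b : Omega n → ℤ}
    (ha : a ∈ barSeq π k) (hb : b ∈ barSeq π⁻¹ l) :
    mergeSeq k π a b ∈ barSeq (1 : hyperoctahedral n) (2 * k * l + k + l) := by
  rw [barSeq_one]
  refine ⟨fun x y hxy => ?_, fun x => ?_, fun x y hxy => ?_⟩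
  · simp only [mergeSeq]
    rw [hb.1 x y hxy, ha.1 ((π⁻¹).1 x) ((π⁻¹).1 y) (oddOn_perm π⁻¹ x y hxy)]
    ring
  · have h1 := abs_le.1 (ha.2.1 ((π⁻¹).1 x))
    have h2 := abs_le.1 (hb.2.1 x)
    have hk : (0 : ℤ) ≤ k := by positivity
    have hN : ((2 * k * l + k + l : ℕ) : ℤ) = 2 * k * l + k + l := by push_cast; rfl
    simp only [mergeSeq, abs_le, hN]
    constructor <;> nlinarith
  · rcases hxy.eq_or_lt with rfl | hlt
    · rfl
    rcases hb.2.2 x y hlt with h | ⟨h, h'⟩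
    · exact ((mul_add_lt_iff_lex (ha.2.1 _) (ha.2.1 _)).2 (Or.inl h)).le
    · have := monotone_of_mem_barSeq ha h'.le
      simp only [mergeSeq, h]
      omega

/-- Breaking the ties of an odd function by position gives an injective odd function. -/
theorem tieBreak_props {n : ℕ} {c : Omega n → ℤ} (hc : OddOn c) :
    OddOn (fun x => c x * (2 * n + 1) + (x : ℤ)) ∧
      Function.Injective (fun x => c x * (2 * n + 1) + (x : ℤ)) := by
  refine ⟨fun x y hxy => ?_, fun x y hxy => ?_⟩
  · simp only [hc x y hxy, hxy]; ring
  · exact Subtype.ext (mul_add_inj x.abs_le y.abs_le hxy).2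

/-- Compatibility of c∘π with π says that π sorts c with ties broken by position; hence c determines
π. -/
theorem strictMono_tieBreak {n k : ℕ} {π : hyperoctahedral n} {a c : Omega n → ℤ}
    (ha : a ∈ barSeq π k) (hac : ∀ x, a x = c (π.1 x)) :
    StrictMono fun x => c (π.1 x) * (2 * n + 1) + (π.1 x : ℤ) := by
  intro x y hxy
  refine (mul_add_lt_iff_lex (Omega.abs_le _) (Omega.abs_le _)).2 ?_
  rw [← hac, ← hac]
  exact ha.2.2 x y hxy

/-- Triples of a signed permutation and two compatible sequences. -/
abbrev BarTriple (n k l : ℕ) : Type :=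
  Σ π : hyperoctahedral n, barSeq π k × barSeq π⁻¹ l

theorem mergeSeq_bijective (n k l : ℕ) : Function.Bijective
    (fun t : BarTriple n k l => (⟨mergeSeq k t.1 t.2.1.1 t.2.2.1, mergeSeq_mem t.2.1.2 t.2.2.2⟩ :
      barSeq (1 : hyperoctahedral n) (2 * k * l + k + l))) := by
  constructor
  · rintro ⟨π, ⟨a, ha⟩, ⟨b, hb⟩⟩ ⟨π', ⟨a', ha'⟩, ⟨b', hb'⟩⟩ h
    have h' : ∀ x, mergeSeq k π a b x = mergeSeq k π' a' b' x := fun x =>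
      congrFun (congrArg Subtype.val h) x
    have key := fun x => mul_add_inj (ha.2.1 _) (ha'.2.1 _) (h' x)
    obtain rfl : b = b' := funext fun x => (key x).1
    have hc : OddOn fun x => a ((π⁻¹).1 x) := fun x y hxy => ha.1 _ _ (oddOn_perm π⁻¹ x y hxy)
    obtain ⟨h1, h2⟩ := tieBreak_props hc
    obtain rfl : π = π' := by
      refine (existsUnique_strictMono_comp h1 h2).unique
        (strictMono_tieBreak (c := fun x => a ((π⁻¹).1 x)) ha fun x => ?_)
        (strictMono_tieBreak (c := fun x => a ((π⁻¹).1 x)) ha' fun x => ?_)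
      · simp only [inv_val_apply']
      · rw [(key _).2, inv_val_apply']
    obtain rfl : a = a' := funext fun x => by
      have := (key (π.1 x)).2
      rwa [inv_val_apply'] at this
    rfl
  · rintro ⟨q, hq⟩
    rw [barSeq_one] at hq
    obtain ⟨hodd, hbd, hmono⟩ := hq
    have hk : (0 : ℤ) < 2 * k + 1 := by positivity
    -- Adding k before dividing centres the remainder in [-k, k].
    let b : Omega n → ℤ := fun x => (q x + k) / (2 * k + 1)
    let c : Omega n → ℤ := fun x => (q x + k) % (2 * k + 1) - k
    have hqbc : ∀ x, q x = b x * (2 * k + 1) + c x := by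
      intro x
      have := Int.mul_ediv_add_emod (q x + k) (2 * k + 1)
      simp only [b, c]
      linarith
    have hcb : ∀ x, |c x| ≤ k := by
      intro x
      have h1 := Int.emod_nonneg (q x + k) hk.ne'
      have h2 := Int.emod_lt_of_pos (q x + k) hk
      simp only [c, abs_le]
      omega
    have hbb : ∀ x, |b x| ≤ l := by
      intro x
      have h1 := abs_le.1 (hbd x)
      have h2 := abs_le.1 (hcb x)
      rw [hqbc] at h1
      push_cast at h1
      rw [abs_le]
      -- If |b x| ≥ l+1, then |q x| ≥ (l+1)(2k+1) - k, which is one more than its bound.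
      constructor <;> by_contra! hlt <;> nlinarith
    have hoddbc : ∀ x y : Omega n, (y : ℤ) = -(x : ℤ) → b y = -b x ∧ c y = -c x := by
      intro x y hxy
      refine mul_add_inj (hcb y) (by rw [abs_neg]; exact hcb x) ?_
      rw [← hqbc, hodd x y hxy, hqbc]; ring
    have hc : OddOn c := fun x y hxy => (hoddbc x y hxy).2
    obtain ⟨h1, h2⟩ := tieBreak_props hc
    obtain ⟨π, hπ, -⟩ := existsUnique_strictMono_comp h1 h2
    have ha : (fun x => c (π.1 x)) ∈ barSeq π k :=
      ⟨fun x y hxy => hc _ _ (oddOn_perm π x y hxy), fun x => hcb _, fun x y hxy =>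
        (mul_add_lt_iff_lex (Omega.abs_le _) (Omega.abs_le _)).1 (hπ hxy)⟩
    have hb : b ∈ barSeq π⁻¹ l := by
      refine ⟨fun x y hxy => (hoddbc x y hxy).1, hbb, fun x y hxy => ?_⟩
      have hle := hmono hxy.le
      have hbxy : b x ≤ b y :=
        Int.ediv_le_ediv hk (by omega)
      rcases hbxy.lt_or_eq with hlt | heq
      · exact .inl hlt
      refine .inr ⟨heq, ?_⟩
      rw [hqbc x, hqbc y, heq] at hle
      -- With equal b-digits, c x ≤ c y; if π⁻¹ reversed x and y, the sorting of c by π would be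
      -- violated.
      by_contra hn
      rcases (not_lt.1 hn).eq_or_lt with he | hlt
      · exact hxy.ne' ((π⁻¹).1.injective he)
      · have := ha.2.2 _ _ hlt
        simp only [inv_val_apply] at this
        have hxy' : (x : ℤ) < y := hxy
        rcases this with h | ⟨_, h⟩
        · omega
        · exact absurd hxy (not_lt.2 h.le)
    refine ⟨⟨π, ⟨_, ha⟩, ⟨b, hb⟩⟩, Subtype.ext (funext fun x => ?_)⟩
    simp only [mergeSeq, inv_val_apply]
    exact (hqbc x).symm

theorem sum_card_barSeq (n k l : ℕ) [Fintype (hyperoctahedral n)] :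
    ∑ π : hyperoctahedral n, Nat.card (barSeq π k) * Nat.card (barSeq π⁻¹ l) =
      Nat.card (barSeq (1 : hyperoctahedral n) (2 * k * l + k + l)) := by
  rw [← Nat.card_eq_of_bijective _ (mergeSeq_bijective n k l), Nat.card_sigma]
  simp only [Nat.card_prod]

/-! ### Counting compatible sequences by descents -/

/-- The descents of `π` among the first `m` indices. -/
def desUpTo {n : ℕ} (π : hyperoctahedral n) (m : ℕ) : Finset (Fin n) :=
  Finset.univ.filter fun i : Fin n => (i : ℕ) < m ∧
    (π.1 (Omega.idx i i.isLt.le) : ℤ) > (π.1 (Omega.idx (i + 1) i.isLt) : ℤ)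

theorem desUpTo_zero {n : ℕ} (π : hyperoctahedral n) : (desUpTo π 0).card = 0 := by
  simp [desUpTo]

theorem desUpTo_self {n : ℕ} (π : hyperoctahedral n) : (desUpTo π n).card = desB π := by
  simp [desUpTo, desB]

theorem desUpTo_succ {n : ℕ} (π : hyperoctahedral n) (i : Fin n) :
    (desUpTo π (i + 1)).card = (desUpTo π i).card +
      if (π.1 (Omega.idx i i.isLt.le) : ℤ) > (π.1 (Omega.idx (i + 1) i.isLt) : ℤ) then 1 else 0 := by
  split_ifs with h
  · have : desUpTo π (i + 1) = insert i (desUpTo π i) := by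
      ext m
      simp only [desUpTo, Finset.mem_insert, Finset.mem_filter, Finset.mem_univ, true_and]
      constructor
      · rintro ⟨h1, h2⟩
        rcases (Nat.lt_succ_iff_lt_or_eq.1 h1) with h3 | h3
        · exact .inr ⟨h3, h2⟩
        · exact .inl (Fin.ext h3)
      · rintro (rfl | ⟨h1, h2⟩)
        · exact ⟨by omega, h⟩
        · exact ⟨by omega, h2⟩
    rw [this, Finset.card_insert_of_notMem (by simp [desUpTo])]
  · rw [add_zero]
    refine congrArg Finset.card (Finset.ext fun m => ?_)
    simp only [desUpTo, Finset.mem_filter, Finset.mem_univ, true_and]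
    refine ⟨fun ⟨h1, h2⟩ => ⟨?_, h2⟩, fun ⟨h1, h2⟩ => ⟨by omega, h2⟩⟩
    rcases (Nat.lt_succ_iff_lt_or_eq.1 h1) with h3 | h3
    · exact h3
    · obtain rfl := Fin.ext h3
      exact absurd h2 h

theorem desB_le {n : ℕ} (π : hyperoctahedral n) : desB π ≤ n := by
  simpa using Finset.card_le_univ (desUpTo π n) |>.trans' (desUpTo_self π).ge

theorem perm_idx_ne {n : ℕ} (π : hyperoctahedral n) (i : Fin n) :
    (π.1 (Omega.idx i i.isLt.le) : ℤ) ≠ π.1 (Omega.idx (i + 1) i.isLt) := by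
  intro h
  have := congrArg Subtype.val (π.1.injective (Subtype.ext h))
  simp [Omega.idx] at this

/-- Bounded odd functions lie in `barSeq π k` as soon as consecutive nonnegative indices are
ordered correctly. -/
theorem mem_barSeq_iff {n : ℕ} {π : hyperoctahedral n} {k : ℕ} {a : Omega n → ℤ} (ha : OddOn a) :
    a ∈ barSeq π k ↔ a (Omega.idx n le_rfl) ≤ k ∧ ∀ i : Fin n,
      a (Omega.idx i i.isLt.le) + ((desUpTo π (i + 1)).card - (desUpTo π i).card : ℤ) ≤
        a (Omega.idx (i + 1) i.isLt) := by
  constructor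
  · rintro ⟨-, h2, h3⟩
    refine ⟨(abs_le.1 (h2 _)).2, fun i => ?_⟩
    have := h3 (Omega.idx i i.isLt.le) (Omega.idx (i + 1) i.isLt) (by
      change (i : ℤ) < ((i + 1 : ℕ) : ℤ); simp)
    rw [desUpTo_succ]
    have h4 : (π.1 (Omega.idx i i.isLt.le) < π.1 (Omega.idx (i + 1) i.isLt)) ↔
      ((π.1 (Omega.idx i i.isLt.le) : ℤ) < π.1 (Omega.idx (i + 1) i.isLt)) := Iff.rfl
    rw [h4] at this
    split_ifs with h <;> push_cast <;> omega
  · rintro ⟨h1, h2⟩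
    -- Encoding the pair (a, π) as one odd function lets the condition on consecutive indices spread
    -- to all pairs.
    have hF : StrictMono fun x => a x * (2 * n + 1) + (π.1 x : ℤ) := by
      refine OddOn.strictMono (fun x y hxy => ?_) fun i => ?_
      · have hπ : (π.1 y : ℤ) = -(π.1 x : ℤ) := oddOn_perm π x y hxy
        rw [ha x y hxy, hπ]; ring
      · refine (mul_add_lt_iff_lex (Omega.abs_le _) (Omega.abs_le _)).2 ?_
        have h3 := h2 i
        have h4 := perm_idx_ne π i
        rw [desUpTo_succ] at h3
        split_ifs at h3 with h <;> push_cast at h3 <;> omega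
    have hlex : ∀ x y, x < y → a x < a y ∨ (a x = a y ∧ π.1 x < π.1 y) := fun x y hxy =>
      (mul_add_lt_iff_lex (Omega.abs_le _) (Omega.abs_le _)).1 (hF hxy)
    have hle : ∀ x, a x ≤ k := fun x => by
      rcases (show x ≤ Omega.idx n le_rfl from x.2.2).eq_or_lt with rfl | hlt
      · exact h1
      · rcases hlex _ _ hlt with h | h <;> omega
    refine ⟨ha, fun x => abs_le.2 ⟨?_, hle x⟩, hlex⟩
    have := hle x.neg
    rw [ha x x.neg rfl] at this
    omega

/-- The odd function on `Ω_n` with prescribed values at the nonnegative indices. -/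
def oddExtend {n : ℕ} (g : ℕ → ℤ) (x : Omega n) : ℤ :=
  if 0 ≤ (x : ℤ) then g (x : ℤ).toNat else -g (-(x : ℤ)).toNat

theorem oddExtend_oddOn {n : ℕ} {g : ℕ → ℤ} (hg : g 0 = 0) : OddOn (oddExtend (n := n) g) := by
  intro x y hxy
  rcases lt_trichotomy (x : ℤ) 0 with h | h | h
  · simp [oddExtend, hxy, h.not_ge, h.le]
  · simp [oddExtend, hxy, h, hg]
  · simp [oddExtend, hxy, h.not_ge, h.le]

theorem oddExtend_idx {n : ℕ} (g : ℕ → ℤ) (j : ℕ) (hj : j ≤ n) :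
    oddExtend g (Omega.idx j hj) = g j := by
  simp [oddExtend, Omega.idx]

theorem OddOn.ext {n : ℕ} {f g : Omega n → ℤ} (hf : OddOn f) (hg : OddOn g)
    (h : ∀ (j : ℕ) (hj : j < n), f (Omega.idx (j + 1) hj) = g (Omega.idx (j + 1) hj)) : f = g := by
  have hpos : ∀ x : Omega n, 0 ≤ (x : ℤ) → f x = g x := by
    intro x hx
    obtain ⟨j, hj, rfl⟩ := Omega.exists_idx hx
    cases j with
    | zero => rw [hf.map_zero, hg.map_zero]
    | succ j => exact h j hj
  ext x
  by_cases hx : 0 ≤ (x : ℤ)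
  · exact hpos x hx
  · have := hpos x.neg (by simp [Omega.neg]; omega)
    rw [hf x x.neg rfl, hg x x.neg rfl] at this
    omega

/-- The strictly increasing sequence attached to an element of `barSeq π k`. -/
def strictSeq {n : ℕ} (π : hyperoctahedral n) (a : Omega n → ℤ) (j : Fin (n + 1)) : ℤ :=
  a (Omega.idx j (Nat.lt_succ_iff.1 j.isLt)) - (desUpTo π j).card + j

theorem strictSeq_strictMono {n : ℕ} {π : hyperoctahedral n} {k : ℕ} {a : Omega n → ℤ}
    (ha : a ∈ barSeq π k) : StrictMono (strictSeq π a) := by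
  refine Fin.strictMono_iff_lt_succ.2 fun i => ?_
  have := ((mem_barSeq_iff ha.1).1 ha).2 i
  simp only [strictSeq, Fin.val_castSucc, Fin.val_succ]
  push_cast
  omega

theorem strictSeq_zero {n : ℕ} (π : hyperoctahedral n) {a : Omega n → ℤ} (ha : OddOn a) :
    strictSeq π a 0 = 0 := by
  have := ha.map_zero
  simp [strictSeq, desUpTo_zero, this]

theorem strictSeq_last {n : ℕ} (π : hyperoctahedral n) (a : Omega n → ℤ) :
    strictSeq π a (Fin.last n) = a (Omega.idx n le_rfl) - desB π + n := by
  simp [strictSeq, desUpTo_self]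

theorem strictSeq_succ_bounds {n : ℕ} {π : hyperoctahedral n} {k : ℕ} {a : Omega n → ℤ}
    (ha : a ∈ barSeq π k) (j : Fin n) :
    0 < strictSeq π a j.succ ∧ (strictSeq π a j.succ - 1).toNat < k + n - desB π := by
  have hm := strictSeq_strictMono ha
  have h1 := hm (Fin.succ_pos j)
  have h2 := hm.monotone (Fin.le_last j.succ)
  rw [strictSeq_zero π ha.1] at h1
  rw [strictSeq_last] at h2
  have h3 := ((mem_barSeq_iff ha.1).1 ha).1
  omega

/-- Elements of `barSeq π k` as strictly increasing sequences. -/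
def barSeqToEmb {n : ℕ} (π : hyperoctahedral n) (k : ℕ) (a : barSeq π k) :
    Fin n ↪o Fin (k + n - desB π) :=
  OrderEmbedding.ofStrictMono
    (fun j => ⟨(strictSeq π a.1 j.succ - 1).toNat, (strictSeq_succ_bounds a.2 j).2⟩)
    fun i j hij => by
      have h1 := strictSeq_strictMono a.2 (Fin.succ_lt_succ_iff.2 hij)
      have h2 := (strictSeq_succ_bounds a.2 i).1
      change (strictSeq π a.1 i.succ - 1).toNat < (strictSeq π a.1 j.succ - 1).toNat
      omega

theorem barSeqToEmb_bijective {n : ℕ} (π : hyperoctahedral n) (k : ℕ) :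
    Function.Bijective (barSeqToEmb π k) := by
  constructor
  · rintro ⟨a, ha⟩ ⟨a', ha'⟩ h
    refine Subtype.ext (ha.1.ext ha'.1 fun j hj => ?_)
    have h1 : (strictSeq π a (Fin.succ ⟨j, hj⟩) - 1).toNat =
        (strictSeq π a' (Fin.succ ⟨j, hj⟩) - 1).toNat :=
      congrArg Fin.val (DFunLike.congr_fun h (⟨j, hj⟩ : Fin n))
    have h2 := (strictSeq_succ_bounds ha ⟨j, hj⟩).1
    have h3 := (strictSeq_succ_bounds ha' ⟨j, hj⟩).1
    have h4 : strictSeq π a (Fin.succ ⟨j, hj⟩) = strictSeq π a' (Fin.succ ⟨j, hj⟩) := by omega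
    simpa [strictSeq] using h4
  · intro f
    -- The strict sequence starts at 0, so its other values are f shifted up by one; `g` below
    -- undoes `strictSeq`.
    let s : ℕ → ℤ := fun j => if h : j - 1 < n ∧ 0 < j then (f ⟨j - 1, h.1⟩ : ℕ) + 1 else 0
    have hs0 : s 0 = 0 := by simp [s]
    have hs1 : ∀ (j : ℕ) (hj : j < n), s (j + 1) = (f ⟨j, hj⟩ : ℕ) + 1 := by
      intro j hj; simp [s, hj]
    have hstep : ∀ j, j < n → s j + 1 ≤ s (j + 1) := by
      intro j hj
      rw [hs1 j hj]
      cases j with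
      | zero => rw [hs0]; omega
      | succ j =>
        rw [hs1 j (by omega)]
        have : f ⟨j, by omega⟩ < f ⟨j + 1, hj⟩ := f.strictMono (by simp)
        have : (f ⟨j, by omega⟩ : ℕ) < f ⟨j + 1, hj⟩ := this
        omega
    have hlast : s n ≤ k + n - desB π := by
      have hd := desB_le π
      cases n with
      | zero => rw [hs0]; omega
      | succ m =>
        rw [hs1 m (by omega)]
        have := (f ⟨m, by omega⟩).isLt
        omega
    let g : ℕ → ℤ := fun j => s j + (desUpTo π j).card - j
    have hg0 : g 0 = 0 := by simp [g, hs0, desUpTo_zero]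
    have hodd := oddExtend_oddOn (n := n) hg0
    have hmem : oddExtend g ∈ barSeq π k := by
      rw [mem_barSeq_iff hodd]
      refine ⟨?_, fun i => ?_⟩
      · rw [oddExtend_idx]
        simp only [g, desUpTo_self]
        omega
      · rw [oddExtend_idx, oddExtend_idx]
        have := hstep i i.isLt
        simp only [g]
        push_cast
        omega
    refine ⟨⟨_, hmem⟩, RelEmbedding.ext fun j => Fin.ext ?_⟩
    change (strictSeq π (oddExtend g) j.succ - 1).toNat = f j
    have : strictSeq π (oddExtend g) j.succ = s (j + 1) := by
      simp only [strictSeq, oddExtend_idx, g, Fin.val_succ]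
      ring
    rw [this, hs1 j j.isLt]
    simp

theorem card_barSeq {n : ℕ} (π : hyperoctahedral n) (k : ℕ) :
    Nat.card (barSeq π k) = (k + n - desB π).choose n := by
  rw [Nat.card_eq_of_bijective _ (barSeqToEmb_bijective π k),
    Nat.card_congr Set.powersetCard.ofFinEmbEquiv, Set.powersetCard.card, Nat.card_fin]

theorem desB_one {n : ℕ} : desB (1 : hyperoctahedral n) = 0 := by
  rw [desB, Finset.card_eq_zero, Finset.filter_eq_empty_iff]
  intro i _
  simp [Omega.idx]

/-! ### The double binomial sum -/

theorem bCount_eq_zero_of_neg (n : ℕ) {i j : ℤ} (h : i < 0 ∨ j < 0) : bCount n i j = 0 := by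
  rw [bCount, Set.ncard_eq_zero, Set.eq_empty_iff_forall_notMem]
  rintro π ⟨h1, h2⟩
  omega

theorem sum_bCount_mul_choose {n : ℕ} (hn : 1 ≤ n) (k l : ℕ) :
    ∑ i ∈ Finset.range (k + 1), ∑ j ∈ Finset.range (l + 1),
      (bCount n i j : ℤ) * ((k + n - i).choose n * (l + n - j).choose n : ℤ) =
        ((2 * k * l + k + l + n).choose n : ℤ) := by
  classical
  have := Fintype.ofFinite (hyperoctahedral n)
  have key := sum_card_barSeq n k l
  simp only [card_barSeq, desB_one, Nat.sub_zero] at key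
  rw [← key]
  push_cast
  have hcount : ∀ i j : ℕ, (bCount n i j : ℤ) =
      ∑ π : hyperoctahedral n, (if desB π = i then 1 else 0) * (if idesB π = j then 1 else 0) := by
    intro i j
    rw [bCount, Set.ncard_eq_toFinset_card']
    simp only [← ite_and, mul_ite, mul_one, mul_zero, Finset.sum_boole, Nat.cast_inj]
    congr 1
    ext π
    simp [and_comm]
  -- This needs n ≥ 1: for n = 0 the truncated subtraction would give C(0, 0) = 1.
  have hvan : ∀ (k i : ℕ), i ∉ Finset.range (k + 1) → ((k + n - i).choose n : ℤ) = 0 := by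
    intro k i hi
    rw [Finset.mem_range] at hi
    exact_mod_cast Nat.choose_eq_zero_of_lt (by omega)
  have hind : ∀ k d : ℕ, ∑ i ∈ Finset.range (k + 1),
      (if d = i then 1 else 0) * ((k + n - i).choose n : ℤ) = (k + n - d).choose n := by
    intro k d
    simp only [ite_mul, one_mul, zero_mul, Finset.sum_ite_eq]
    split_ifs with h
    · rfl
    · exact (hvan k d h).symm
  simp only [hcount, Finset.sum_mul]
  simp only [Finset.sum_comm (t := (Finset.univ : Finset (hyperoctahedral n)))]
  refine Finset.sum_congr rfl fun π _ => ?_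
  rw [← hind k (desB π), ← hind l (desB π⁻¹), Finset.sum_mul_sum]
  refine Finset.sum_congr rfl fun i _ => Finset.sum_congr rfl fun j _ => ?_
  rw [idesB]
  ring

/-! ### From the double sum to the recurrence -/

/-- A convolution against shifted binomial coefficients determines the coefficients. -/
theorem eq_of_sum_choose_eq {n : ℕ} {f g : ℕ → ℕ → ℤ}
    (h : ∀ k l : ℕ, ∑ i ∈ Finset.range (k + 1), ∑ j ∈ Finset.range (l + 1),
        f i j * ((k + n - i).choose n * (l + n - j).choose n : ℤ) =
      ∑ i ∈ Finset.range (k + 1), ∑ j ∈ Finset.range (l + 1),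
        g i j * ((k + n - i).choose n * (l + n - j).choose n : ℤ)) (k l : ℕ) :
    f k l = g k l := by
  suffices H : ∀ m k l : ℕ, k + l = m → f k l = g k l from H _ k l rfl
  intro m
  induction m using Nat.strong_induction_on with
  | _ m ih =>
    rintro k l rfl
    have key := h k l
    rw [Finset.sum_range_succ, Finset.sum_range_succ (n := k), Finset.sum_range_succ (n := l),
      Finset.sum_range_succ (n := l)] at key
    -- All terms but the corner (k, l) have smaller index sum and cancel by induction; the corner
    -- has weight C(n, n)² = 1.
    rw [Finset.sum_congr rfl fun i hi => Finset.sum_congr rfl fun j hj => by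
        rw [ih (i + j) (by simp at hi hj; omega) i j rfl],
      Finset.sum_congr (s₁ := Finset.range l) rfl fun j hj => by
        rw [ih (k + j) (by simp at hj; omega) k j rfl]] at key
    simpa using key

theorem natCast_mul_choose_add_one (n m : ℕ) :
    ((n + 1 : ℕ) : ℤ) * ((m + (n + 1)).choose (n + 1) : ℤ) =
      (m + n + 1) * ((m + n).choose n : ℤ) := by
  have := Nat.add_one_mul_choose_eq (m + n) n
  rw [show m + (n + 1) = m + n + 1 by ring]
  have h : ((m + n + 1 : ℕ) : ℤ) * ((m + n).choose n : ℤ) =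
    ((m + n + 1).choose (n + 1) : ℤ) * ((n + 1 : ℕ) : ℤ) := by exact_mod_cast this
  rw [mul_comm, ← h]
  push_cast
  ring

theorem natCast_mul_choose_of_le {n k i : ℕ} (hi : i ≤ k) :
    ((n + 1 : ℕ) : ℤ) * ((k + (n + 1) - i).choose (n + 1) : ℤ) =
      (k - i + n + 1) * ((k + n - i).choose n : ℤ) := by
  obtain ⟨m, rfl⟩ := Nat.exists_eq_add_of_le hi
  rw [show i + m + (n + 1) - i = m + (n + 1) by omega, show i + m + n - i = m + n by omega,
    natCast_mul_choose_add_one]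
  push_cast
  ring

theorem natCast_mul_choose_succ_of_le {n k i : ℕ} (hi : i ≤ k) :
    ((n + 1 : ℕ) : ℤ) * ((k + (n + 1) - (i + 1)).choose (n + 1) : ℤ) =
      (k - i) * ((k + n - i).choose n : ℤ) := by
  obtain ⟨m, rfl⟩ := Nat.exists_eq_add_of_le hi
  rw [show i + m + (n + 1) - (i + 1) = m + n by omega, show i + m + n - i = m + n by omega]
  have := Nat.choose_succ_right_eq (m + n) n
  rw [show m + n - n = m by omega] at this
  have h : ((m + n).choose (n + 1) : ℤ) * ((n + 1 : ℕ) : ℤ) = ((m + n).choose n : ℤ) * m := by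
    exact_mod_cast this
  rw [mul_comm, h]
  push_cast
  ring

theorem sum_range_shift {f g : ℤ → ℤ} (hf : f (-1) = 0) {k : ℕ} (hg : g (k + 1) = 0) :
    ∑ i ∈ Finset.range (k + 1), f ((i : ℤ) - 1) * g i =
      ∑ i ∈ Finset.range (k + 1), f i * g (i + 1) := by
  rw [Finset.sum_range_succ', Finset.sum_range_succ]
  simp [hf, hg]

/-- If the double sums of `b n` against shifted binomial coefficients are
`(2kl+k+l+n).choose n`, then `b n` satisfies the recurrence for the two-sided Eulerian numbers of
type B. -/
theorem recurrence_of_sum_choose {n : ℕ} {b c : ℤ → ℤ → ℤ}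
    (hb : ∀ i j : ℤ, i < 0 ∨ j < 0 → b i j = 0)
    (hbsum : ∀ k l : ℕ, ∑ i ∈ Finset.range (k + 1), ∑ j ∈ Finset.range (l + 1),
      b i j * ((k + n - i).choose n * (l + n - j).choose n : ℤ) =
        ((2 * k * l + k + l + n).choose n : ℤ))
    (hcsum : ∀ k l : ℕ, ∑ i ∈ Finset.range (k + 1), ∑ j ∈ Finset.range (l + 1),
      c i j * ((k + (n + 1) - i).choose (n + 1) * (l + (n + 1) - j).choose (n + 1) : ℤ) =
        ((2 * k * l + k + l + (n + 1)).choose (n + 1) : ℤ)) (i j : ℕ) :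
    ((n + 1 : ℕ) : ℤ) * c i j =
      (((n + 1 : ℕ) : ℤ) + i + j + 2 * i * j) * b i j
      + ((2 * ((n + 1 : ℕ) : ℤ) - 1) * i - (2 * i + 1) * (j - 1)) * b i (j - 1)
      + ((2 * ((n + 1 : ℕ) : ℤ) - 1) * j - (2 * j + 1) * (i - 1)) * b (i - 1) j
      + ((2 * ((n + 1 : ℕ) : ℤ) ^ 2 - ((n + 1 : ℕ) : ℤ)) + 2 * (i - 1) * (j - 1)
          + (1 - 2 * ((n + 1 : ℕ) : ℤ)) * (i + j - 2)) * b (i - 1) (j - 1) := by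
  refine eq_of_sum_choose_eq (n := n + 1) (f := fun i j : ℕ => ((n + 1 : ℕ) : ℤ) * c i j)
    (g := fun i j : ℕ => (((n + 1 : ℕ) : ℤ) + i + j + 2 * i * j) * b i j
      + ((2 * ((n + 1 : ℕ) : ℤ) - 1) * i - (2 * i + 1) * (j - 1)) * b i (j - 1)
      + ((2 * ((n + 1 : ℕ) : ℤ) - 1) * j - (2 * j + 1) * (i - 1)) * b (i - 1) j
      + ((2 * ((n + 1 : ℕ) : ℤ) ^ 2 - ((n + 1 : ℕ) : ℤ)) + 2 * (i - 1) * (j - 1)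
          + (1 - 2 * ((n + 1 : ℕ) : ℤ)) * (i + j - 2)) * b (i - 1) (j - 1))
    (fun k l => ?_) i j
  simp only [mul_assoc ((n + 1 : ℕ) : ℤ) (c _ _), ← Finset.mul_sum]
  rw [hcsum, natCast_mul_choose_add_one]
  set N : ℤ := ((n + 1 : ℕ) : ℤ) with hN
  -- Integer arguments allow index shifts; the boundary terms vanish since u k (k+1) = C(n, n+1) = 0
  -- and b is zero at index -1.
  let u : ℕ → ℤ → ℤ := fun k i => ((k + (n + 1) - i.toNat).choose (n + 1) : ℤ)
  have hu : ∀ k i : ℕ, ((k + (n + 1) - i).choose (n + 1) : ℤ) = u k i := fun k i => by simp [u]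
  have hu0 : ∀ k : ℕ, u k (k + 1) = 0 := fun k => by
    simp only [u, Nat.cast_eq_zero]
    exact Nat.choose_eq_zero_of_lt (by omega)
  have hu1 : ∀ k i : ℕ, i ≤ k → N * u k i = (k - i + N) * ((k + n - i).choose n : ℤ) :=
    fun k i h => by
      rw [← hu, natCast_mul_choose_of_le h, hN]; push_cast; ring
  have hu2 : ∀ k i : ℕ, i ≤ k → N * u k (i + 1) = (k - i) * ((k + n - i).choose n : ℤ) :=
    fun k i h => by
      rw [← natCast_mul_choose_succ_of_le h, hN, hu k (i + 1)]; push_cast; rfl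
  have hshiftj : ∀ F : ℤ → ℤ → ℤ, (∀ i, F i (-1) = 0) → ∀ g : ℤ → ℤ,
      ∑ i ∈ Finset.range (k + 1), ∑ j ∈ Finset.range (l + 1), F i (j - 1) * (g i * u l j) =
      ∑ i ∈ Finset.range (k + 1), ∑ j ∈ Finset.range (l + 1), F i j * (g i * u l (j + 1)) :=
    fun F hF g => Finset.sum_congr rfl fun i _ =>
      sum_range_shift (f := fun j => F i j) (g := fun j => g i * u l j) (hF _) (by simp [hu0])
  have hshifti : ∀ F : ℤ → ℤ → ℤ, (∀ j, F (-1) j = 0) → ∀ g : ℤ → ℤ,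
      ∑ i ∈ Finset.range (k + 1), ∑ j ∈ Finset.range (l + 1), F (i - 1) j * (u k i * g j) =
      ∑ i ∈ Finset.range (k + 1), ∑ j ∈ Finset.range (l + 1), F i j * (u k (i + 1) * g j) :=
    fun F hF g => by
      rw [Finset.sum_comm, Finset.sum_comm (s := Finset.range (k + 1))]
      exact Finset.sum_congr rfl fun j _ =>
        sum_range_shift (f := fun i => F i j) (g := fun i => u k i * g j) (hF _) (by simp [hu0])
  simp only [hu, add_mul _ _ (u k _ * u l _), Finset.sum_add_distrib]
  have e2 := hshiftj (fun i j => ((2 * N - 1) * i - (2 * i + 1) * j) * b i j)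
    (fun i => by rw [hb _ _ (.inr (by norm_num)), mul_zero]) (u k)
  have e3 := hshifti (fun i j => ((2 * N - 1) * j - (2 * j + 1) * i) * b i j)
    (fun i => by rw [hb _ _ (.inl (by norm_num)), mul_zero]) (u l)
  have e4 := hshiftj (fun i j => (2 * N ^ 2 - N + 2 * (i - 1) * j + (1 - 2 * N) * (i + j - 1)) *
    b (i - 1) j) (fun i => by rw [hb _ _ (.inr (by norm_num)), mul_zero]) (u k)
  have e4' := hshifti (fun i j => (2 * N ^ 2 - N + 2 * i * j + (1 - 2 * N) * (i + j)) * b i j)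
    (fun i => by rw [hb _ _ (.inl (by norm_num)), mul_zero]) (fun j => u l (j + 1))
  simp only [show ∀ i j : ℤ, i + (j - 1) - 1 = i + j - 2 by intros; ring] at e4
  simp only [show ∀ i j : ℤ, i - 1 + j = i + j - 1 by intros; ring] at e4'
  rw [e2, e3, e4, e4']
  simp only [← Finset.sum_add_distrib]
  -- One factor N for each binomial turns every weight into a polynomial times the common product U
  -- V, so the terms can be compared one by one.
  refine mul_left_cancel₀ (a := N ^ 2) (by positivity) ?_
  have hs := hbsum k l
  rw [← hs, Finset.mul_sum, Finset.mul_sum, Finset.mul_sum]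
  refine Finset.sum_congr rfl fun i hi => ?_
  rw [Finset.mul_sum, Finset.mul_sum, Finset.mul_sum]
  refine Finset.sum_congr rfl fun j hj => ?_
  have hi' : i ≤ k := by simpa [Nat.lt_succ_iff] using hi
  have hj' : j ≤ l := by simpa [Nat.lt_succ_iff] using hj
  have hn : (n : ℤ) = N - 1 := by rw [hN]; push_cast; ring
  have a1 := hu1 k i hi'
  have a2 := hu2 k i hi'
  have b1 := hu1 l j hj'
  have b2 := hu2 l j hj'
  generalize ((k + n - i).choose n : ℤ) = U at *
  generalize ((l + n - j).choose n : ℤ) = V at *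
  have p11 := congrArg₂ (· * ·) a1 b1
  have p12 := congrArg₂ (· * ·) a1 b2
  have p21 := congrArg₂ (· * ·) a2 b1
  have p22 := congrArg₂ (· * ·) a2 b2
  push_cast
  rw [hn]
  linear_combination (-(N + i + j + 2 * i * j) * b i j) * p11
    - ((2 * N - 1) * i - (2 * i + 1) * j) * b i j * p12
    - ((2 * N - 1) * j - (2 * j + 1) * i) * b i j * p21
    - (2 * N ^ 2 - N + 2 * i * j + (1 - 2 * N) * (i + j)) * b i j * p22

/-- The double sum at k, l ∈ {0, 1} is a triangular system for these four values. -/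
theorem bCount_one_values : bCount 1 0 0 = 1 ∧ bCount 1 1 1 = 1 ∧ bCount 1 0 1 = 0 ∧
    bCount 1 1 0 = 0 := by
  have h00 := sum_bCount_mul_choose le_rfl 0 0
  have h01 := sum_bCount_mul_choose le_rfl 0 1
  have h10 := sum_bCount_mul_choose le_rfl 1 0
  have h11 := sum_bCount_mul_choose le_rfl 1 1
  simp [Finset.sum_range_succ] at h00 h01 h10 h11
  omega

theorem mainTheorem1 :
    (∀ n : ℕ, 2 ≤ n → ∀ i j : ℤ, 0 ≤ i → i ≤ n → 0 ≤ j → j ≤ n →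
      (n : ℤ) * (bCount n i j : ℤ) =
        ((n : ℤ) + i + j + 2 * i * j) * (bCount (n - 1) i j : ℤ)
        + ((2 * (n : ℤ) - 1) * i - (2 * i + 1) * (j - 1)) * (bCount (n - 1) i (j - 1) : ℤ)
        + ((2 * (n : ℤ) - 1) * j - (2 * j + 1) * (i - 1)) * (bCount (n - 1) (i - 1) j : ℤ)
        + ((2 * (n : ℤ) ^ 2 - n) + 2 * (i - 1) * (j - 1) + (1 - 2 * (n : ℤ)) * (i + j - 2))
          * (bCount (n - 1) (i - 1) (j - 1) : ℤ))
    ∧ bCount 1 0 0 = 1 ∧ bCount 1 1 1 = 1 ∧ bCount 1 0 1 = 0 ∧ bCount 1 1 0 = 0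
    ∧ (∀ (n : ℕ) (i j : ℤ), 1 ≤ n → (i < 0 ∨ j < 0) → bCount n i j = 0) := by
  obtain ⟨h00, h11, h01, h10⟩ := bCount_one_values
  refine ⟨fun n hn i j hi _ hj _ => ?_, h00, h11, h01, h10,
    fun n i j _ h => bCount_eq_zero_of_neg n h⟩
  obtain ⟨m, rfl⟩ := Nat.exists_eq_add_of_le' (show 1 ≤ n by omega)
  lift i to ℕ using hi
  lift j to ℕ using hj
  exact recurrence_of_sum_choose (b := fun i j => (bCount m i j : ℤ))
    (c := fun i j => (bCount (m + 1) i j : ℤ))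
    (fun i j h => by rw [bCount_eq_zero_of_neg m h, Nat.cast_zero])
    (sum_bCount_mul_choose (by omega)) (sum_bCount_mul_choose (by omega)) i j
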